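/- For $f$ on $\mathbb{R}^2$ let $\hat f(\xi)=\int_{\mathbb{R}^2} e^{-2\pi i x\cdot\xi}f(x)\,dx$ denote the Fourier transform (extended to tempered distributions). For $s\in\mathbb{R}$ let $H^s(\mathbb{R}^2)$ be the space of tempered distributions $f$ with $\|f\|_{H^s}=\big\|(1+|\xi|^2)^{s/2}\hat f(\xi)\big\|_{L^2(\mathbb{R}^2)}<\infty$. For $f$ with $\hat f\in L^1(\mathbb{R}^2)$ let $$e^{it\Delta}f(x)=\int_{\mathbb{R}^2}e^{2\pi i x\cdot\xi+4\pi^2 i t|\xi|^2}\hat f(\xi)\,d\xi,\qquad x\in\mathbb{R}^2,\ t\in\mathbb{R}.$$ Let $\alpha\in[1/2,1)$, $e_1=(1,0)$, $\gamma(x,t)=x-e_1t^{\alpha}$, and let $s\in\mathbb{R}$. Suppose that there is a constant $C<\infty$ such that $$\Big\|\sup_{0<t<1}\big|e^{it\Delta}f(\gamma(x,t))\big|\Big\|_{L^1(B(0,1))}\le C\,\|f\|_{H^s(\mathbb{R}^2)}$$ for all $f\in H^s(\mathbb{R}^2)$ with $\hat f\in L^1(\mathbb{R}^2)$ (the $f\in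 H^s$ for which the formula above defines $e^{it\Delta}f$ at every point; this holds in particular if the estimate holds for all $f\in H^s(\mathbb{R}^2)$, for any extension of $e^{it\Delta}$ to $H^s$ that agrees with this formula). Then $s\ge 1/3$. -/

import Mathlib

open MeasureTheory TemperedDistribution
open scoped FourierTransform SchwartzMap ENNReal NNReal

/-- The Euclidean plane `ℝ²`. -/
abbrev Plane : Type := EuclideanSpace ℝ (Fin 2)

/-- The Bessel potential of `f` is represented by at most one `L²` function. -/
theorem besselPotential_repr_unique {s : ℝ} {f : 𝓢'(Plane, ℂ)}
    {g h : Lp ℂ 2 (volume : Measure Plane)}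
    (hg : besselPotential Plane ℂ s f = g) (hh : besselPotential Plane ℂ s f = h) : g = h := by
  have hk := LinearMap.ker_eq_bot.mp
    (Lp.ker_toTemperedDistributionCLM_eq_bot (E := Plane) (F := ℂ) (μ := volume) (p := 2))
  apply hk
  simpa [Lp.toTemperedDistributionCLM_apply] using hg.symm.trans hh

/-- The norm of `f ∈ H^s(ℝ²)`: the `L²` norm of the function representing
`𝓕⁻ ((1 + |ξ|²)^(s/2) 𝓕 f)`, which equals the `L²` norm of `(1 + |ξ|²)^(s/2) 𝓕 f`. -/
noncomputable def sobolevNorm (s : ℝ) (f : 𝓢'(Plane, ℂ)) (hf : MemSobolev s 2 f) : ℝ≥0 :=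
  ‖hf.choose‖₊

theorem sobolevNorm_eq {s : ℝ} {f : 𝓢'(Plane, ℂ)} (hf : MemSobolev s 2 f)
    {g : Lp ℂ 2 (volume : Measure Plane)} (hg : besselPotential Plane ℂ s f = g) :
    sobolevNorm s f hf = ‖g‖₊ := by
  rw [sobolevNorm, besselPotential_repr_unique hf.choose_spec hg]

/-- The value at `x` and time `t` of the Schrödinger evolution `e^{itP(D)} f`, `P(ξ) = |ξ|²`, of
the `f` whose Fourier transform is the integrable function `fhat`.  The Fourier transform is
`𝓕 f ξ = ∫ e^{-2πi x·ξ} f x dx`, so that the angular frequency is `2πξ` and `P` becomes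
`4π²|ξ|²`. -/
noncomputable def schrodingerEvolution (fhat : Plane → ℂ) (t : ℝ) (x : Plane) : ℂ :=
  ∫ ξ : Plane, Complex.exp
    (Complex.I * ((2 * Real.pi * inner ℝ x ξ + 4 * Real.pi ^ 2 * t * ‖ξ‖ ^ 2 : ℝ) : ℂ)) * fhat ξ

/-- The tangential curve `γ(x, t) = x - e₁ t^α`, `e₁ = (1, 0)`. -/
noncomputable def tangentialCurve (α : ℝ) (x : Plane) (t : ℝ) : Plane :=
  x - t ^ α • EuclideanSpace.single (0 : Fin 2) (1 : ℝ)

/-- The `L¹(B(0,1))` norm of `x ↦ sup_{0 < t < 1} |e^{itΔ} f (γ(x, t))|`, in `[0, ∞]`. -/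
noncomputable def tangentialMaximalNorm (α : ℝ) (fhat : Plane → ℂ) : ℝ≥0∞ :=
  ∫⁻ x in Metric.ball (0 : Plane) 1,
    ⨆ t ∈ Set.Ioo (0 : ℝ) 1, ‖schrodingerEvolution fhat t (tangentialCurve α x t)‖ₑ

/-- The maximal estimate `‖sup_{0<t<1} |e^{itΔ} f (γ(x, t))|‖_{L¹(B(0,1))} ≤ C ‖f‖_{H^s}`, with `C`
independent of `f`, for all `f ∈ H^s(ℝ²)` whose Fourier transform is integrable, so that
`e^{itΔ} f` is defined at every point. -/
def TangentialMaximalEstimate (α s : ℝ) : Prop :=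
  ∃ C : ℝ≥0, ∀ (f : 𝓢'(Plane, ℂ)) (hf : MemSobolev s 2 f)
    (fhat : Lp ℂ 1 (volume : Measure Plane)), 𝓕 f = (fhat : 𝓢'(Plane, ℂ)) →
      tangentialMaximalNorm α fhat ≤ C * sobolevNorm s f hf

/-! The estimate is tested, for large `n`, on the `f` whose Fourier transform is the indicator of
`frequencyComb n`. With `R = n¹²` and `D = n⁸`, the comb has `n⁴` boxes of size `n⁶/1000 × 1/1000`
with corners `(R, lD)`, so frequencies are `O(R)` and `‖f‖_{H^s} ≲ R^σ n⁵`, where `σ = max s 0`.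

For a prime `p ∼ n²` take `t = b/(2πp n¹⁶)`, so that the quadratic phase `4π²t(lD)²` is `2πbl²/p`.
If also `D x₁` is within `n⁻⁴/100` of `a/p`, the sum over `l` is close to `n⁴/p` complete Gauss sums
of modulus `√p`, hence of size at least about `n³`. Integration over the offset in a box gives
`|e^{itΔ}f| ≳ n⁹`. For this the phase must vary little over the box: the integer `b` is chosen with
`4πtR ≈ -x₀` up to `O(n⁻⁶)`, the inverse of the box length, and the tangential shift obeys `t^α ≤ √t
≲ n⁻⁶` because `α ≥ 1/2`.

The admissible `x₁` form disjoint intervals of length about `n⁻¹²`. There are about `n²/log n`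
primes and `n¹⁰` numerators for each, so the good set has measure `≳ 1/log n`. The estimate forces
`n⁹/log n ≲ n^{12σ} n⁵`, which fails for large `n` if `σ < 1/3`. -/

/-- The axis-parallel box `[a, b] × [c, d]` in the plane. -/
def planeBox (a b c d : ℝ) : Set Plane := {x | x 0 ∈ Set.Icc a b ∧ x 1 ∈ Set.Icc c d}

theorem planeBox_eq_preimage (a b c d : ℝ) :
    planeBox a b c d = (MeasurableEquiv.toLp 2 (Fin 2 → ℝ)).symm ⁻¹'
      (Set.univ.pi fun i => Set.Icc (![a, c] i) (![b, d] i)) := by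
  ext x
  simp [planeBox, Fin.forall_fin_two, Pi.le_def]
  tauto

theorem measurableSet_planeBox (a b c d : ℝ) : MeasurableSet (planeBox a b c d) := by
  rw [planeBox_eq_preimage]
  exact (MeasurableEquiv.measurable _) (MeasurableSet.univ_pi fun i => measurableSet_Icc)

theorem volume_planeBox (a b c d : ℝ) :
    volume (planeBox a b c d) = ENNReal.ofReal (b - a) * ENNReal.ofReal (d - c) := by
  rw [planeBox_eq_preimage, (EuclideanSpace.volume_preserving_symm_measurableEquiv_toLp
    (Fin 2)).measure_preimage_equiv, Set.pi_univ_Icc, Real.volume_Icc_pi]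
  simp [Fin.prod_univ_two]

theorem schrodingerEvolution_congr_ae {g h : Plane → ℂ} (hgh : g =ᵐ[volume] h) (t : ℝ)
    (x : Plane) : schrodingerEvolution g t x = schrodingerEvolution h t x := by
  unfold schrodingerEvolution
  apply integral_congr_ae
  filter_upwards [hgh] with ξ hξ
  rw [hξ]

theorem tangentialMaximalNorm_congr_ae {g h : Plane → ℂ} (hgh : g =ᵐ[volume] h) (α : ℝ) :
    tangentialMaximalNorm α g = tangentialMaximalNorm α h := by
  unfold tangentialMaximalNorm
  simp_rw [schrodingerEvolution_congr_ae hgh]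

/-! ### Testing the estimate on indicators in frequency -/

/-- The maximal estimate applied to the inverse Fourier transform of the indicator of a set on
which the Sobolev weight is bounded. -/
theorem TangentialMaximalEstimate.indicator_le {α s : ℝ} (hest : TangentialMaximalEstimate α s) :
    ∃ C : ℝ≥0, ∀ (S : Set Plane) (B : ℝ), MeasurableSet S → volume S ≠ ∞ → 0 ≤ B →
      (∀ ξ ∈ S, (1 + ‖ξ‖ ^ 2) ^ (s / 2) ≤ B) →
      tangentialMaximalNorm α (S.indicator 1) ≤
        ENNReal.ofReal (C * (B * √(volume.real S))) := by
  obtain ⟨C, hC⟩ := hest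
  refine ⟨C, fun S B hS hvol hB hw => ?_⟩
  set w : Plane → ℝ := fun ξ => (1 + ‖ξ‖ ^ 2) ^ (s / 2) with hwdef
  have hwt : (fun ξ => (w ξ : ℂ)).HasTemperateGrowth := by
    rw [hwdef]; fun_prop
  have hwcont : Continuous w := by
    rw [hwdef]
    exact Continuous.rpow_const (by fun_prop) fun x => Or.inl (by positivity)
  have hw0 : ∀ ξ, 0 ≤ w ξ := fun ξ => by positivity
  have hone : MemLp (S.indicator (1 : Plane → ℂ)) 1 volume :=
    memLp_indicator_const 1 hS (1 : ℂ) (Or.inr hvol)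
  have hmeas : AEStronglyMeasurable (S.indicator fun ξ => (w ξ : ℂ)) volume :=
    ((Complex.continuous_ofReal.comp hwcont).stronglyMeasurable.indicator hS).aestronglyMeasurable
  have hbound : ∀ ξ, ‖S.indicator (fun ξ => (w ξ : ℂ)) ξ‖ ≤
      ‖S.indicator (fun _ => (B : ℂ)) ξ‖ := by
    intro ξ
    by_cases hξ : ξ ∈ S
    · simpa [hξ, abs_of_nonneg hB, abs_of_nonneg (hw0 ξ)] using hw ξ hξ
    · simp [hξ]
  have hBm : MemLp (S.indicator fun _ => (B : ℂ)) 2 (volume : Measure Plane) :=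
    memLp_indicator_const 2 hS (B : ℂ) (Or.inr hvol)
  have hwm : MemLp (S.indicator fun ξ => (w ξ : ℂ)) 2 (volume : Measure Plane) :=
    hBm.of_le hmeas (Filter.Eventually.of_forall hbound)
  set F : Lp ℂ 1 (volume : Measure Plane) := hone.toLp with hF
  set G : Lp ℂ 2 (volume : Measure Plane) := hwm.toLp with hG
  have hmul : smulLeftCLM ℂ (fun ξ => (w ξ : ℂ)) (F : 𝓢'(Plane, ℂ)) = (G : 𝓢'(Plane, ℂ)) := by
    ext φ
    rw [smulLeftCLM_apply_apply, Lp.toTemperedDistribution_apply, Lp.toTemperedDistribution_apply]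
    apply integral_congr_ae
    filter_upwards [hone.coeFn_toLp, hwm.coeFn_toLp] with ξ h1 h2
    rw [hF, hG, h1, h2, SchwartzMap.smulLeftCLM_apply_apply hwt]
    by_cases hξ : ξ ∈ S <;> simp [hξ, mul_comm]
  set f : 𝓢'(Plane, ℂ) := 𝓕⁻ (F : 𝓢'(Plane, ℂ)) with hf
  have hFf : 𝓕 f = (F : 𝓢'(Plane, ℂ)) := FourierTransform.fourier_fourierInv_eq _
  have hbessel : besselPotential Plane ℂ s f = ((𝓕⁻ G : Lp ℂ 2 volume) : 𝓢'(Plane, ℂ)) := by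
    rw [besselPotential, fourierMultiplierCLM_apply, hFf, hmul,
      Lp.fourierInv_toTemperedDistribution_eq]
  have hmem : MemSobolev s 2 f := ⟨_, hbessel⟩
  have hnormG : ‖(𝓕⁻ G : Lp ℂ 2 volume)‖ = ‖G‖ := by
    rw [← Lp.norm_fourier_eq, FourierTransform.fourier_fourierInv_eq]
  have hG_le : ‖G‖ ≤ B * √(volume.real S) := by
    rw [hG, Lp.norm_toLp]
    have h1 : eLpNorm (S.indicator fun ξ => (w ξ : ℂ)) 2 volume ≤
        eLpNorm (S.indicator fun _ => (B : ℂ)) 2 volume := eLpNorm_mono hbound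
    have h2 := ENNReal.toReal_mono hBm.eLpNorm_ne_top h1
    refine h2.trans (le_of_eq ?_)
    rw [eLpNorm_indicator_const hS (by norm_num) (by norm_num)]
    simp [ENNReal.toReal_mul, ← ENNReal.toReal_rpow, abs_of_nonneg hB, Real.sqrt_eq_rpow,
      Measure.real]
  have key := hC f hmem F hFf
  rw [tangentialMaximalNorm_congr_ae hone.coeFn_toLp] at key
  refine key.trans ?_
  rw [sobolevNorm_eq hmem hbessel, ENNReal.ofReal_mul C.coe_nonneg, ENNReal.ofReal_coe_nnreal]
  gcongr
  rw [← ENNReal.ofReal_coe_nnreal]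
  exact ENNReal.ofReal_le_ofReal (by rw [coe_nnnorm, hnormG]; exact hG_le)

/-! ### Complete and incomplete Gauss sums -/

/-- The Gauss sum `∑ ψ(b l² + a l)` over `ZMod p` has modulus `√p`. -/
theorem norm_quadratic_stdAddChar_sum {p : ℕ} [Fact p.Prime] (hp2 : p ≠ 2) (a b : ZMod p)
    (hb : b ≠ 0) : ‖∑ x : ZMod p, ZMod.stdAddChar (b * x ^ 2 + a * x)‖ = √p := by
  set G := ∑ x : ZMod p, ZMod.stdAddChar (b * x ^ 2 + a * x) with hG
  have h2 : (2 : ZMod p) ≠ 0 := by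
    have := ZMod.natCast_eq_zero_iff 2 p
    intro h
    have h3 : p ∣ 2 := this.mp (by exact_mod_cast h)
    exact hp2 ((Nat.prime_dvd_prime_iff_eq Fact.out Nat.prime_two).mp h3)
  -- After the shift `x ↦ x + y` the terms `b y²` cancel, so the sum over `y` is a linear character
  -- sum with frequency `2bx`. Since `2b ≠ 0`, orthogonality leaves only `x = 0`.
  have hsq : G * (starRingEnd ℂ) G = p := by
    have hconj : ∀ y : ZMod p, (starRingEnd ℂ) (ZMod.stdAddChar y) = ZMod.stdAddChar (-y) :=
      fun y => (AddChar.map_neg_eq_conj _ _).symm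
    calc G * (starRingEnd ℂ) G
        = ∑ y : ZMod p, ∑ x : ZMod p, ZMod.stdAddChar (b * (x + y) ^ 2 + a * (x + y)) *
            ZMod.stdAddChar (-(b * y ^ 2 + a * y)) := by
          rw [hG, map_sum, Finset.sum_mul_sum, Finset.sum_comm]
          refine Finset.sum_congr rfl fun y _ => ?_
          simp_rw [hconj]
          exact (Fintype.sum_equiv (Equiv.addRight y) _ _ fun x => rfl).symm
      _ = ∑ x : ZMod p, ZMod.stdAddChar (b * x ^ 2 + a * x) *
            ∑ y : ZMod p, ZMod.stdAddChar (y * (2 * b * x)) := by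
          rw [Finset.sum_comm]
          refine Finset.sum_congr rfl fun x _ => ?_
          rw [Finset.mul_sum]
          refine Finset.sum_congr rfl fun y _ => ?_
          rw [← AddChar.map_add_eq_mul, ← AddChar.map_add_eq_mul]
          congr 1
          ring
      _ = p := by
          simp_rw [AddChar.sum_mulShift _ (ZMod.isPrimitive_stdAddChar p)]
          simp [hb, h2, ZMod.card]
  rw [Complex.mul_conj, Complex.normSq_eq_norm_sq] at hsq
  have hsq' : ‖G‖ ^ 2 = p := by exact_mod_cast hsq
  rw [← hsq', Real.sqrt_sq (norm_nonneg _)]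

theorem norm_quadratic_exp_sum {p : ℕ} (hp : p.Prime) (hp2 : p ≠ 2) (a b : ℤ)
    (hb : ¬ (p : ℤ) ∣ b) :
    ‖∑ l ∈ Finset.range p, Complex.exp (2 * Real.pi * Complex.I * (b * l ^ 2 + a * l) / p)‖
      = √p := by
  have : Fact p.Prime := ⟨hp⟩
  have hb' : (b : ZMod p) ≠ 0 := by rwa [Ne, ZMod.intCast_zmod_eq_zero_iff_dvd]
  rw [← norm_quadratic_stdAddChar_sum hp2 (a : ZMod p) (b : ZMod p) hb']
  congr 1
  have h1 : ∀ l : ℕ, Complex.exp (2 * Real.pi * Complex.I * (b * l ^ 2 + a * l) / p) =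
      ZMod.stdAddChar ((b : ZMod p) * (l : ZMod p) ^ 2 + (a : ZMod p) * (l : ZMod p)) := by
    intro l
    have := ZMod.stdAddChar_coe (N := p) (b * (l : ℤ) ^ 2 + a * (l : ℤ))
    push_cast at this
    rw [this]
  simp_rw [h1]
  refine Finset.sum_bij' (fun l _ => (l : ZMod p)) (fun x _ => x.val) ?_ ?_ ?_ ?_ ?_
  · simp
  · intro x _
    exact Finset.mem_range.mpr (ZMod.val_lt x)
  · intro l hl
    exact ZMod.val_cast_of_lt (Finset.mem_range.mp hl)
  · intro x _
    exact ZMod.natCast_zmod_val x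
  · intro l _
    rfl

/-- A sum of a `p`-periodic sequence against a slowly varying weight is close to the number of
complete periods times the sum over one period. -/
theorem norm_periodic_mul_sum_sub_le {p : ℕ} (z w : ℕ → ℂ) (N : ℕ) {ε δ : ℝ}
    (hz : Function.Periodic z p) (hz1 : ∀ l, ‖z l‖ ≤ 1) (hw1 : ∀ l, ‖w l‖ ≤ 1)
    (hwε : ∀ l < N, ‖w l - 1‖ ≤ ε) (hδ : ∀ l, ∀ r < p, ‖w (l + r) - w l‖ ≤ δ) (hp : 0 < p) :
    ‖∑ l ∈ Finset.range N, z l * w l - (N / p : ℕ) * ∑ l ∈ Finset.range p, z l‖ ≤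
      (N / p : ℕ) * (ε * ‖∑ l ∈ Finset.range p, z l‖ + p * δ) + p := by
  set G := ∑ l ∈ Finset.range p, z l with hG
  set M := N / p with hM
  have hsplit : ∑ l ∈ Finset.range N, z l * w l =
      ∑ l ∈ Finset.range (M * p), z l * w l +
        ∑ r ∈ Finset.range (N % p), z (M * p + r) * w (M * p + r) := by
    rw [← Finset.sum_range_add, mul_comm M p, hM, Nat.div_add_mod]
  have hblock : ∀ K : ℕ, ∑ l ∈ Finset.range (K * p), z l * w l =
      ∑ j ∈ Finset.range K, ∑ r ∈ Finset.range p, z r * w (j * p + r) := by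
    intro K
    induction K with
    | zero => simp
    | succ K ih =>
      rw [Nat.succ_mul, Finset.sum_range_add, ih, Finset.sum_range_succ]
      congr 1
      refine Finset.sum_congr rfl fun r _ => ?_
      have : z (K * p + r) = z r := by
        rw [add_comm]
        simpa using hz.nat_mul K r
      rw [this]
  have hrest : ‖∑ r ∈ Finset.range (N % p), z (M * p + r) * w (M * p + r)‖ ≤ p := by
    refine (norm_sum_le_of_le _ (f := fun r => z (M * p + r) * w (M * p + r))
      (n := fun _ => (1 : ℝ)) fun r _ => ?_).trans ?_
    · rw [norm_mul]
      exact mul_le_one₀ (hz1 _) (norm_nonneg _) (hw1 _)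
    · simpa using (Nat.mod_lt N hp).le
  have hone : ∀ j ∈ Finset.range M,
      ‖∑ r ∈ Finset.range p, z r * w (j * p + r) - G‖ ≤ ε * ‖G‖ + p * δ := by
    intro j hj
    have hj' : j * p < N := by
      have h1 : j < N / p := Finset.mem_range.mp hj
      have h2 : (j + 1) * p ≤ N := (Nat.le_div_iff_mul_le hp).mp h1
      nlinarith
    -- On one period, `ε` pays for replacing the weight at the start of the block by `1`, and `δ`
    -- for freezing it within the block.
    have heq : ∑ r ∈ Finset.range p, z r * w (j * p + r) - G =
        (w (j * p) - 1) * G + ∑ r ∈ Finset.range p, z r * (w (j * p + r) - w (j * p)) := by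
      rw [hG, Finset.mul_sum, ← Finset.sum_add_distrib, ← Finset.sum_sub_distrib]
      refine Finset.sum_congr rfl fun r _ => ?_
      ring
    rw [heq]
    refine (norm_add_le _ _).trans (add_le_add ?_ ?_)
    · rw [norm_mul]
      gcongr
      exact hwε _ hj'
    · refine (norm_sum_le_of_le _ (f := fun r => z r * (w (j * p + r) - w (j * p)))
        (n := fun _ => δ) fun r hr => ?_).trans (by simp)
      rw [norm_mul]
      have h3 := hδ (j * p) r (Finset.mem_range.mp hr)
      calc ‖z r‖ * ‖w (j * p + r) - w (j * p)‖ ≤ 1 * ‖w (j * p + r) - w (j * p)‖ := by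
            gcongr; exact hz1 r
        _ ≤ δ := by rwa [one_mul]
  have hmain : ‖∑ l ∈ Finset.range (M * p), z l * w l - M * G‖ ≤ M * (ε * ‖G‖ + p * δ) := by
    have : ∑ l ∈ Finset.range (M * p), z l * w l - M * G =
        ∑ j ∈ Finset.range M, (∑ r ∈ Finset.range p, z r * w (j * p + r) - G) := by
      rw [hblock, Finset.sum_sub_distrib]
      simp
    rw [this]
    refine (norm_sum_le_of_le _ hone).trans (by simp [mul_add])
  rw [hsplit, add_sub_right_comm]
  exact (norm_add_le _ _).trans (add_le_add hmain hrest)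

/-! ### The frequency comb -/

/-- A union of `n⁴` thin boxes, spaced by `n⁸` in the second frequency and located at height `n¹²`
in the first one. -/
def frequencyComb (n : ℕ) : Set Plane :=
  ⋃ l ∈ Finset.range (n ^ 4),
    planeBox ((n : ℝ) ^ 12) ((n : ℝ) ^ 12 + (n : ℝ) ^ 6 / 1000)
      (l * (n : ℝ) ^ 8) (l * (n : ℝ) ^ 8 + 1 / 1000)

theorem measurableSet_frequencyComb (n : ℕ) : MeasurableSet (frequencyComb n) :=
  Finset.measurableSet_biUnion _ fun _ _ => measurableSet_planeBox _ _ _ _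

theorem volume_frequencyComb_le (n : ℕ) :
    volume (frequencyComb n) ≤ ENNReal.ofReal ((n : ℝ) ^ 10 / 1000 ^ 2) := by
  refine (measure_biUnion_finset_le _ _).trans ?_
  simp_rw [volume_planeBox, add_sub_cancel_left]
  rw [← ENNReal.ofReal_mul (by positivity), Finset.sum_const, Finset.card_range, nsmul_eq_mul,
    ← ENNReal.ofReal_natCast, ← ENNReal.ofReal_mul (by positivity)]
  apply ENNReal.ofReal_le_ofReal
  push_cast
  apply le_of_eq
  ring

theorem norm_sq_le_of_mem_frequencyComb {n : ℕ} (hn : 1 ≤ n) {ξ : Plane}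
    (hξ : ξ ∈ frequencyComb n) : 1 + ‖ξ‖ ^ 2 ≤ 9 * (n : ℝ) ^ 24 := by
  simp only [frequencyComb, Set.mem_iUnion, Finset.mem_range, planeBox, Set.mem_ofPred_eq,
    Set.mem_Icc] at hξ
  obtain ⟨l, hl, ⟨h0, h0'⟩, h1, h1'⟩ := hξ
  have hn1 : (1 : ℝ) ≤ n := by exact_mod_cast hn
  have hl' : (l : ℝ) + 1 ≤ (n : ℝ) ^ 4 := by exact_mod_cast hl
  have h12 : (n : ℝ) ^ 6 ≤ (n : ℝ) ^ 12 := pow_le_pow_right₀ hn1 (by norm_num)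
  have h1le : (1 : ℝ) ≤ (n : ℝ) ^ 12 := one_le_pow₀ hn1
  have h8 : (1 : ℝ) ≤ (n : ℝ) ^ 8 := one_le_pow₀ hn1
  have hlD : ((l : ℝ) + 1) * (n : ℝ) ^ 8 ≤ (n : ℝ) ^ 12 := by
    calc ((l : ℝ) + 1) * (n : ℝ) ^ 8 ≤ (n : ℝ) ^ 4 * (n : ℝ) ^ 8 := by gcongr
      _ = (n : ℝ) ^ 12 := by ring
  have ha : ξ 0 ≤ 2 * (n : ℝ) ^ 12 := by linarith
  have ha0 : 0 ≤ ξ 0 := by linarith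
  have hb : ξ 1 ≤ (n : ℝ) ^ 12 := by nlinarith
  have hb0 : 0 ≤ ξ 1 := le_trans (by positivity) h1
  rw [EuclideanSpace.norm_sq_eq, Fin.sum_univ_two, Real.norm_of_nonneg ha0,
    Real.norm_of_nonneg hb0]
  have h24 : (n : ℝ) ^ 24 = (n : ℝ) ^ 12 * (n : ℝ) ^ 12 := by ring
  rw [h24]
  nlinarith

theorem disjoint_frequencyComb_boxes {n : ℕ} (hn : 1 ≤ n) :
    Set.PairwiseDisjoint (↑(Finset.range (n ^ 4))) fun l : ℕ =>
      planeBox ((n : ℝ) ^ 12) ((n : ℝ) ^ 12 + (n : ℝ) ^ 6 / 1000)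
        (l * (n : ℝ) ^ 8) (l * (n : ℝ) ^ 8 + 1 / 1000) := by
  have h8 : (1 : ℝ) ≤ (n : ℝ) ^ 8 := one_le_pow₀ (by exact_mod_cast hn)
  have aux : ∀ l m : ℕ, l < m → ∀ y : ℝ, y ≤ l * (n : ℝ) ^ 8 + 1 / 1000 →
      m * (n : ℝ) ^ 8 ≤ y → False := by
    intro l m hlm y h1 h2
    have : (l : ℝ) + 1 ≤ m := by exact_mod_cast hlm
    nlinarith
  intro l _ m _ hlm
  refine Set.disjoint_left.mpr fun x hx hx' => ?_
  rcases lt_or_gt_of_ne hlm with h | h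
  · exact aux l m h (x 1) hx.2.2 hx'.2.1
  · exact aux m l h (x 1) hx'.2.2 hx.2.1

/-! ### Evolution of the comb as an average of exponential sums -/

/-- The phase of the Schrödinger evolution. -/
noncomputable def schrodingerPhase (t : ℝ) (x ξ : Plane) : ℝ :=
  2 * Real.pi * inner ℝ x ξ + 4 * Real.pi ^ 2 * t * ‖ξ‖ ^ 2

theorem continuous_exp_schrodingerPhase (t : ℝ) (x : Plane) :
    Continuous fun ξ => Complex.exp (Complex.I * (schrodingerPhase t x ξ : ℂ)) := by
  unfold schrodingerPhase
  fun_prop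

theorem norm_exp_I_mul_ofReal (θ : ℝ) : ‖Complex.exp (Complex.I * (θ : ℂ))‖ = 1 := by
  rw [mul_comm, Complex.norm_exp_ofReal_mul_I]

theorem integrableOn_exp_schrodingerPhase (t : ℝ) (x : Plane) {S : Set Plane}
    (hvol : volume S ≠ ∞) :
    IntegrableOn (fun ξ => Complex.exp (Complex.I * (schrodingerPhase t x ξ : ℂ))) S := by
  refine Measure.integrableOn_of_bounded (M := 1) hvol
    (continuous_exp_schrodingerPhase t x).aestronglyMeasurable ?_
  exact Filter.Eventually.of_forall fun ξ => (norm_exp_I_mul_ofReal _).le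

theorem volume_planeBox_ne_top (a b c d : ℝ) : volume (planeBox a b c d) ≠ ∞ := by
  rw [volume_planeBox]
  exact ENNReal.mul_ne_top ENNReal.ofReal_ne_top ENNReal.ofReal_ne_top

/-- Translating every box to the origin exposes, for each fixed offset `η`, an exponential sum in
`l`, to which the Gauss sum bounds apply. -/
theorem schrodingerEvolution_frequencyComb {n : ℕ} (hn : 1 ≤ n) (t : ℝ) (x : Plane) :
    schrodingerEvolution ((frequencyComb n).indicator 1) t x =
      ∫ η in planeBox 0 ((n : ℝ) ^ 6 / 1000) 0 (1 / 1000), ∑ l ∈ Finset.range (n ^ 4),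
        Complex.exp (Complex.I *
          (schrodingerPhase t x (η + !₂[(n : ℝ) ^ 12, l * (n : ℝ) ^ 8]) : ℂ)) := by
  have h1 : schrodingerEvolution ((frequencyComb n).indicator 1) t x =
      ∫ ξ in frequencyComb n, Complex.exp (Complex.I * (schrodingerPhase t x ξ : ℂ)) := by
    rw [← integral_indicator (measurableSet_frequencyComb n)]
    unfold schrodingerEvolution schrodingerPhase
    refine integral_congr_ae (Filter.Eventually.of_forall fun ξ => ?_)
    by_cases hξ : ξ ∈ frequencyComb n <;> simp [hξ]
  rw [h1, frequencyComb, integral_biUnion_finset _ (fun _ _ => measurableSet_planeBox _ _ _ _)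
    (disjoint_frequencyComb_boxes hn)
    (fun l _ => integrableOn_exp_schrodingerPhase t x (volume_planeBox_ne_top _ _ _ _)),
    integral_finsetSum]
  · refine Finset.sum_congr rfl fun l _ => ?_
    set v : Plane := !₂[(n : ℝ) ^ 12, l * (n : ℝ) ^ 8] with hv
    have hpre : planeBox 0 ((n : ℝ) ^ 6 / 1000) 0 (1 / 1000) = (fun η => η + v) ⁻¹'
        planeBox ((n : ℝ) ^ 12) ((n : ℝ) ^ 12 + (n : ℝ) ^ 6 / 1000)
          (l * (n : ℝ) ^ 8) (l * (n : ℝ) ^ 8 + 1 / 1000) := by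
      ext η
      simp [planeBox, hv, add_comm]
    rw [hpre, (measurePreserving_add_right volume v).setIntegral_preimage_emb
      (MeasurableEquiv.addRight v).measurableEmbedding
      (fun ξ => Complex.exp (Complex.I * (schrodingerPhase t x ξ : ℂ)))]
  · intro l _
    refine Measure.integrableOn_of_bounded (M := 1) (volume_planeBox_ne_top _ _ _ _) ?_ ?_
    · exact ((continuous_exp_schrodingerPhase t x).comp
        (continuous_id.add continuous_const)).aestronglyMeasurable
    · exact Filter.Eventually.of_forall fun ξ => (norm_exp_I_mul_ofReal _).le

/-- Number of complete periods times the modulus of the Gauss sum, bounded below. -/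
theorem cube_le_periods_mul_sqrt {n p : ℕ} (hn : 40 ≤ n) (hpn : p ≤ n ^ 2) (hnp : n ^ 2 ≤ 4 * p) :
    (n : ℝ) ^ 3 / 4 ≤ (n ^ 4 / p : ℕ) * √p := by
  have hn' : (40 : ℝ) ≤ n := by exact_mod_cast hn
  have hp0 : 0 < p := by nlinarith
  have hM : n ^ 2 ≤ n ^ 4 / p := by
    rw [Nat.le_div_iff_mul_le hp0]
    calc n ^ 2 * p ≤ n ^ 2 * n ^ 2 := by gcongr
      _ = n ^ 4 := by ring
  have hM' : (n : ℝ) ^ 2 ≤ (n ^ 4 / p : ℕ) := by exact_mod_cast hM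
  have hs : (n : ℝ) / 2 ≤ √p := by
    apply Real.le_sqrt_of_sq_le
    have : (n : ℝ) ^ 2 ≤ 4 * p := by exact_mod_cast hnp
    linarith
  calc (n : ℝ) ^ 3 / 4 ≤ (n : ℝ) ^ 2 * (n / 2) := by
        have : 0 ≤ (n : ℝ) ^ 3 := by positivity
        linarith [show (n : ℝ) ^ 2 * (n / 2) = n ^ 3 / 2 by ring]
    _ ≤ _ := by gcongr

theorem norm_exp_I_sub_exp_I_le (θ φ : ℝ) :
    ‖Complex.exp (Complex.I * (θ : ℂ)) - Complex.exp (Complex.I * (φ : ℂ))‖ ≤ |θ - φ| := by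
  have : Complex.exp (Complex.I * (θ : ℂ)) - Complex.exp (Complex.I * (φ : ℂ)) =
      Complex.exp (Complex.I * (φ : ℂ)) * (Complex.exp (Complex.I * ((θ - φ : ℝ) : ℂ)) - 1) := by
    rw [mul_sub, ← Complex.exp_add, mul_one]
    congr 2
    push_cast
    ring
  rw [this, norm_mul, norm_exp_I_mul_ofReal, one_mul]
  exact Real.norm_exp_I_mul_ofReal_sub_one_le

/-- A quadratic exponential sum with denominator `p` and a slowly varying perturbation is close to
the corresponding multiple of the Gauss sum. -/
theorem norm_perturbed_quadratic_sum_sub_le {n p : ℕ} (hn : 40 ≤ n) (hp : p.Prime)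
    (hpn : p ≤ n ^ 2) (hnp : n ^ 2 ≤ 4 * p) (a b : ℤ) (hb : ¬ (p : ℤ) ∣ b) {δ β : ℝ}
    (hδ : |δ| ≤ 1 / 8) (hβ : |β| * (n : ℝ) ^ 4 ≤ 7 / 100) (φ : ℝ) :
    ‖∑ l ∈ Finset.range (n ^ 4), Complex.exp (Complex.I *
        ((φ + 2 * Real.pi * (b * (l : ℝ) ^ 2 + a * l) / p + (δ + l * β) : ℝ) : ℂ)) -
      Complex.exp (Complex.I * (φ : ℂ)) * ((n ^ 4 / p : ℕ) * ∑ l ∈ Finset.range p,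
        Complex.exp (2 * Real.pi * Complex.I * (b * l ^ 2 + a * l) / p))‖ ≤
      (n ^ 4 / p : ℕ) * √p / 2 := by
  have hn' : (40 : ℝ) ≤ n := by exact_mod_cast hn
  have hp2 : p ≠ 2 := by rintro rfl; nlinarith
  have hp0 : (p : ℂ) ≠ 0 := by exact_mod_cast hp.ne_zero
  have hpn' : (p : ℝ) ≤ (n : ℝ) ^ 2 := by exact_mod_cast hpn
  set z : ℕ → ℂ := fun l => Complex.exp (2 * Real.pi * Complex.I * (b * l ^ 2 + a * l) / p) with hz
  set w : ℕ → ℂ := fun l => Complex.exp (Complex.I * ((δ + l * β : ℝ) : ℂ)) with hw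
  have hzper : Function.Periodic z p := by
    intro l
    simp only [hz]
    rw [Complex.exp_eq_exp_iff_exists_int]
    refine ⟨b * (2 * l + p) + a, ?_⟩
    push_cast
    field_simp
    ring
  have hz1 : ∀ l, ‖z l‖ ≤ 1 := by
    intro l
    have : z l = Complex.exp (Complex.I * ((2 * Real.pi * (b * (l : ℝ) ^ 2 + a * l) / p : ℝ) : ℂ)) := by
      simp only [hz]
      congr 1
      push_cast
      ring
    rw [this, norm_exp_I_mul_ofReal]
  have hterm : ∀ l : ℕ, Complex.exp (Complex.I *
        ((φ + 2 * Real.pi * (b * (l : ℝ) ^ 2 + a * l) / p + (δ + l * β) : ℝ) : ℂ)) =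
      Complex.exp (Complex.I * (φ : ℂ)) * (z l * w l) := by
    intro l
    simp only [hz, hw]
    rw [← Complex.exp_add, ← Complex.exp_add]
    congr 1
    push_cast
    ring
  have hG : ‖∑ l ∈ Finset.range p, z l‖ = √p := norm_quadratic_exp_sum hp hp2 a b hb
  have hN0 : (0 : ℝ) < (n : ℝ) ^ 4 := by positivity
  have hβ' : |β| ≤ 7 / 100 / (n : ℝ) ^ 4 := by rwa [le_div_iff₀ hN0]
  -- The constant `1/5` covers `|δ| + l|β| ≤ 1/8 + 7/100`.
  have hwε : ∀ l < n ^ 4, ‖w l - 1‖ ≤ 1 / 5 := by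
    intro l hl
    have hl' : (l : ℝ) ≤ (n : ℝ) ^ 4 := by exact_mod_cast hl.le
    refine Real.norm_exp_I_mul_ofReal_sub_one_le.trans ?_
    rw [Real.norm_eq_abs]
    refine (abs_add_le _ _).trans ?_
    rw [abs_mul, Nat.abs_cast]
    have : (l : ℝ) * |β| ≤ 7 / 100 := le_trans (by rw [mul_comm]; gcongr) hβ
    linarith
  have hwδ : ∀ l, ∀ r < p, ‖w (l + r) - w l‖ ≤ 7 / 100 / (p : ℝ) := by
    intro l r hr
    refine (norm_exp_I_sub_exp_I_le _ _).trans ?_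
    have h1 : δ + ((l + r : ℕ) : ℝ) * β - (δ + l * β) = r * β := by push_cast; ring
    rw [h1, abs_mul, Nat.abs_cast]
    have hr' : (r : ℝ) ≤ p := by exact_mod_cast hr.le
    have hp0' : (0 : ℝ) < p := by exact_mod_cast hp.pos
    rw [le_div_iff₀ hp0']
    calc (r : ℝ) * |β| * p ≤ p * |β| * p := by gcongr
      _ = |β| * p ^ 2 := by ring
      _ ≤ |β| * ((n : ℝ) ^ 2) ^ 2 := by gcongr
      _ = |β| * (n : ℝ) ^ 4 := by ring
      _ ≤ 7 / 100 := hβ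
  have key := norm_periodic_mul_sum_sub_le z w (n ^ 4) hzper hz1
    (fun l => (norm_exp_I_mul_ofReal _).le) hwε hwδ hp.pos
  rw [Finset.sum_congr rfl fun l _ => hterm l, ← Finset.mul_sum, ← mul_sub, norm_mul,
    norm_exp_I_mul_ofReal, one_mul]
  refine key.trans ?_
  rw [hG]
  have hcube := cube_le_periods_mul_sqrt hn hpn hnp
  set M : ℝ := ((n ^ 4 / p : ℕ) : ℝ) with hM
  have hM0 : 0 ≤ M := Nat.cast_nonneg _
  have hs1 : 1 ≤ √(p : ℝ) := Real.one_le_sqrt.mpr (by exact_mod_cast hp.one_le)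
  have hpd : (p : ℝ) * (7 / 100 / p) = 7 / 100 := by
    have : (p : ℝ) ≠ 0 := by exact_mod_cast hp.ne_zero
    field_simp
  rw [hpd]
  -- The incomplete last period is absorbed using `n ≥ 40`: `p ≤ n² ≤ n³/40 ≤ M√p/10`. The three
  -- relative errors `1/5`, `7/100` and `1/10` add up to less than `1/2`.
  have h2 : (p : ℝ) ≤ M * √p / 10 := by
    have : (n : ℝ) ^ 2 ≤ (n : ℝ) ^ 3 / 40 := by
      have : (n : ℝ) ^ 3 = n * n ^ 2 := by ring
      nlinarith [sq_nonneg (n : ℝ)]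
    linarith
  have h3 : M * (7 / 100) ≤ M * √p * (7 / 100) := by nlinarith
  have h4 : 0 ≤ M * √p := by positivity
  linarith [mul_add M (1 / 5 * √(p : ℝ)) (7 / 100)]

/-- If all the phases of the translated boxes are small affine perturbations of a quadratic phase
with prime denominator, the evolution of the frequency comb is large. -/
theorem le_norm_schrodingerEvolution_of_phase {n p : ℕ} (hn : 40 ≤ n) (hp : p.Prime)
    (hpn : p ≤ n ^ 2) (hnp : n ^ 2 ≤ 4 * p) (a b : ℤ) (hb : ¬ (p : ℤ) ∣ b) (t : ℝ) (y : Plane)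
    (φ : ℝ) (δ β : Plane → ℝ)
    (hphase : ∀ η ∈ planeBox 0 ((n : ℝ) ^ 6 / 1000) 0 (1 / 1000), ∀ l : ℕ,
      schrodingerPhase t y (η + !₂[(n : ℝ) ^ 12, l * (n : ℝ) ^ 8]) =
        φ + 2 * Real.pi * (b * (l : ℝ) ^ 2 + a * l) / p + (δ η + l * β η))
    (hδ : ∀ η ∈ planeBox 0 ((n : ℝ) ^ 6 / 1000) 0 (1 / 1000), |δ η| ≤ 1 / 8)
    (hβ : ∀ η ∈ planeBox 0 ((n : ℝ) ^ 6 / 1000) 0 (1 / 1000), |β η| * (n : ℝ) ^ 4 ≤ 7 / 100) :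
    (n : ℝ) ^ 9 / 8000000 ≤
      ‖schrodingerEvolution ((frequencyComb n).indicator 1) t y‖ := by
  have hp2 : p ≠ 2 := by rintro rfl; nlinarith
  rw [schrodingerEvolution_frequencyComb (by linarith)]
  set Ω := planeBox 0 ((n : ℝ) ^ 6 / 1000) 0 (1 / 1000) with hΩ
  set F : Plane → ℂ := fun η => ∑ l ∈ Finset.range (n ^ 4), Complex.exp (Complex.I *
    (schrodingerPhase t y (η + !₂[(n : ℝ) ^ 12, l * (n : ℝ) ^ 8]) : ℂ)) with hF
  set K : ℂ := Complex.exp (Complex.I * (φ : ℂ)) * ((n ^ 4 / p : ℕ) * ∑ l ∈ Finset.range p,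
        Complex.exp (2 * Real.pi * Complex.I * (b * l ^ 2 + a * l) / p)) with hK
  have hKnorm : ‖K‖ = (n ^ 4 / p : ℕ) * √p := by
    rw [hK, norm_mul, norm_exp_I_mul_ofReal, one_mul, norm_mul,
      norm_quadratic_exp_sum hp hp2 a b hb, Complex.norm_natCast]
  have hclose : ∀ η ∈ Ω, ‖F η - K‖ ≤ (n ^ 4 / p : ℕ) * √p / 2 := by
    intro η hη
    simp only [hF]
    rw [Finset.sum_congr rfl fun l _ => by rw [hphase η hη l]]
    exact norm_perturbed_quadratic_sum_sub_le hn hp hpn hnp a b hb (hδ η hη) (hβ η hη) φ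
  have hvol : volume Ω < ∞ := (volume_planeBox_ne_top _ _ _ _).lt_top
  have hvolr : volume.real Ω = (n : ℝ) ^ 6 / 1000 ^ 2 := by
    rw [Measure.real, hΩ, volume_planeBox, ← ENNReal.ofReal_mul (by simp; positivity),
      ENNReal.toReal_ofReal (by rw [sub_zero, sub_zero]; positivity)]
    ring
  have hFint : IntegrableOn F Ω := by
    have hcont : Continuous F := continuous_finsetSum _ fun l _ =>
      (continuous_exp_schrodingerPhase t y).comp (continuous_id.add continuous_const)
    refine Measure.integrableOn_of_bounded (M := (n ^ 4 : ℕ)) hvol.ne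
      hcont.aestronglyMeasurable (Filter.Eventually.of_forall fun η => ?_)
    refine (norm_sum_le_of_le _ (n := fun _ => (1 : ℝ)) fun l _ => ?_).trans (by simp)
    exact (norm_exp_I_mul_ofReal _).le
  have hdiff : ‖∫ η in Ω, (F η - K)‖ ≤ (n ^ 4 / p : ℕ) * √p / 2 * volume.real Ω :=
    norm_setIntegral_le_of_norm_le_const hvol hclose
  rw [integral_sub hFint (integrableOn_const hvol.ne), setIntegral_const] at hdiff
  have htri : ‖volume.real Ω • K‖ - ‖∫ η in Ω, F η‖ ≤
      ‖(∫ η in Ω, F η) - volume.real Ω • K‖ := by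
    rw [norm_sub_rev]
    exact norm_sub_norm_le _ _
  rw [norm_smul, hKnorm, hvolr, Real.norm_of_nonneg (by positivity)] at htri
  rw [hvolr] at hdiff
  have hcube := cube_le_periods_mul_sqrt hn hpn hnp
  -- The main term is at least `n⁹/4000000`, and the error is at most half of the main term.
  have hmul : (n : ℝ) ^ 6 / 1000 ^ 2 * ((n : ℝ) ^ 3 / 4) ≤
      (n : ℝ) ^ 6 / 1000 ^ 2 * ((n ^ 4 / p : ℕ) * √p) := by gcongr
  have h9 : (n : ℝ) ^ 6 / 1000 ^ 2 * ((n : ℝ) ^ 3 / 4) = (n : ℝ) ^ 9 / 4000000 := by ring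
  linarith

/-! ### Choice of the time and control of the phase -/

/-- Every nonnegative real is within `2` below an integer that `p` does not divide. -/
theorem exists_int_not_dvd {p : ℕ} (hp : 2 ≤ p) (u : ℝ) :
    ∃ b : ℤ, ¬ (p : ℤ) ∣ b ∧ u ≤ b ∧ (b : ℝ) ≤ u + 2 := by
  have h1 := Int.le_ceil u
  have h2 := Int.ceil_lt_add_one u
  by_cases h : (p : ℤ) ∣ ⌈u⌉
  · refine ⟨⌈u⌉ + 1, fun h' => ?_, by push_cast; linarith, by push_cast; linarith⟩
    have h3 : (p : ℤ) ∣ 1 := (Int.dvd_add_right h).mp h'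
    have := Int.le_of_dvd one_pos h3
    omega
  · exact ⟨⌈u⌉, h, h1, by linarith⟩

/-- At a point whose second coordinate is close to a fraction with prime denominator, the evolution
of the frequency comb is large at some time along the tangential curve. -/
theorem exists_time_le_norm_schrodingerEvolution {α : ℝ} (hα : 1 / 2 ≤ α) {n p : ℕ} (hn : 40 ≤ n)
    (hp : p.Prime) (hpn : p ≤ n ^ 2) (hnp : n ^ 2 ≤ 4 * p) (a : ℤ) {x : Plane}
    (hx0 : x 0 ∈ Set.Icc (-1 / 2 : ℝ) (-1 / 4)) (hx1 : x 1 ∈ Set.Icc (0 : ℝ) 1)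
    (hxa : |(n : ℝ) ^ 8 * x 1 - a / p| * (n : ℝ) ^ 4 ≤ 1 / 100) :
    ∃ t ∈ Set.Ioo (0 : ℝ) 1, (n : ℝ) ^ 9 / 8000000 ≤
      ‖schrodingerEvolution ((frequencyComb n).indicator 1) t (tangentialCurve α x t)‖ := by
  have hn' : (40 : ℝ) ≤ n := by exact_mod_cast hn
  have hn0 : (0 : ℝ) < n := by linarith
  have hp0 : (0 : ℝ) < p := by exact_mod_cast hp.pos
  have hnp' : (n : ℝ) ^ 2 ≤ 4 * p := by exact_mod_cast hnp
  have hπ := Real.pi_pos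
  have hπ3 := Real.pi_gt_three
  have hπ4 := Real.pi_lt_d2
  obtain ⟨hx0l, hx0u⟩ := hx0
  obtain ⟨hx1l, hx1u⟩ := hx1
  -- Solving `4πtR = -x₀` for `b` gives `p n⁴(-x₀)/2`; rounding it up costs at most `2` in `b`, and
  -- `b` must stay prime to `p` for the Gauss sum.
  obtain ⟨b, hb, hbl, hbu⟩ := exists_int_not_dvd hp.two_le (p * (n : ℝ) ^ 4 * (-x 0) / 2)
  set t : ℝ := b / (2 * Real.pi * p * (n : ℝ) ^ 16) with ht
  have htb : 2 * Real.pi * t * (n : ℝ) ^ 16 = b / p := by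
    rw [ht]; field_simp
  have hpn4 : 0 < (p : ℝ) * (n : ℝ) ^ 4 := by positivity
  -- The time is close to `-x₀ / (4 π n¹²)`.
  have hT : 4 * Real.pi * t * (n : ℝ) ^ 12 * (p * (n : ℝ) ^ 4) = 2 * b := by
    rw [ht]; field_simp; ring
  have hTl : 0 ≤ 4 * Real.pi * t * (n : ℝ) ^ 12 + x 0 := by
    by_contra! h
    nlinarith
  -- The `16` is `4 · 4`: the rounding gives `2b + p n⁴ x₀ ≤ 4`, and `n⁶ ≤ 4p n⁴`.
  have hTu : (4 * Real.pi * t * (n : ℝ) ^ 12 + x 0) * (n : ℝ) ^ 6 ≤ 16 := by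
    have h1 : (4 * Real.pi * t * (n : ℝ) ^ 12 + x 0) * (p * (n : ℝ) ^ 4) ≤ 4 := by
      rw [add_mul, hT]; linarith
    have h2 : (4 * Real.pi * t * (n : ℝ) ^ 12 + x 0) * (n : ℝ) ^ 6 ≤
        4 * ((4 * Real.pi * t * (n : ℝ) ^ 12 + x 0) * (p * (n : ℝ) ^ 4)) := by
      calc (4 * Real.pi * t * (n : ℝ) ^ 12 + x 0) * (n : ℝ) ^ 6 =
          (4 * Real.pi * t * (n : ℝ) ^ 12 + x 0) * ((n : ℝ) ^ 2 * (n : ℝ) ^ 4) := by ring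
        _ ≤ (4 * Real.pi * t * (n : ℝ) ^ 12 + x 0) * (4 * p * (n : ℝ) ^ 4) := by gcongr
        _ = _ := by ring
    linarith
  have hn6 : (40 : ℝ) ≤ (n : ℝ) ^ 6 := hn'.trans (le_self_pow₀ (by linarith) (by norm_num))
  have hT1 : 4 * Real.pi * t * (n : ℝ) ^ 12 ≤ 1 := by nlinarith
  have hT0 : 0 < 4 * Real.pi * t * (n : ℝ) ^ 12 := by linarith
  have hn12 : (0 : ℝ) < (n : ℝ) ^ 12 := by positivity
  have ht0 : 0 < t := by
    by_contra! h
    have : 4 * Real.pi * t * (n : ℝ) ^ 12 ≤ 0 :=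
      mul_nonpos_of_nonpos_of_nonneg (mul_nonpos_of_nonneg_of_nonpos (by positivity) h) hn12.le
    linarith
  have htn : t * (n : ℝ) ^ 12 ≤ 1 / 12 := by
    have h0 : 0 ≤ t * (n : ℝ) ^ 12 := by positivity
    nlinarith
  have ht1 : t < 1 := by
    have : (1 : ℝ) ≤ (n : ℝ) ^ 12 := one_le_pow₀ (by linarith)
    nlinarith
  -- This is where `α ≥ 1/2` enters: the shift along the curve is at most the inverse of the scale
  -- `n⁶` of the box.
  have htα : t ^ α * (n : ℝ) ^ 6 ≤ 1 := by
    have h1 : t ^ α ≤ √t := by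
      rw [Real.sqrt_eq_rpow]
      exact Real.rpow_le_rpow_of_exponent_ge ht0 ht1.le hα
    have h2 : √t * (n : ℝ) ^ 6 = √(t * (n : ℝ) ^ 12) := by
      rw [Real.sqrt_mul ht0.le, show (n : ℝ) ^ 12 = ((n : ℝ) ^ 6) ^ 2 by ring,
        Real.sqrt_sq (by positivity)]
    calc t ^ α * (n : ℝ) ^ 6 ≤ √t * (n : ℝ) ^ 6 := by gcongr
      _ = √(t * (n : ℝ) ^ 12) := h2
      _ ≤ 1 := Real.sqrt_le_one.mpr (by linarith)
  have htα0 : 0 ≤ t ^ α := Real.rpow_nonneg ht0.le _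
  refine ⟨t, ⟨ht0, ht1⟩, ?_⟩
  set R : ℝ := (n : ℝ) ^ 12 with hR
  set D : ℝ := (n : ℝ) ^ 8 with hD
  set y0 : ℝ := x 0 - t ^ α with hy0
  -- The phase is expanded in `η` and `l`. The product `R t^α` need not be small, but it sits in the
  -- constant phase `φ`, which does not affect the modulus.
  refine le_norm_schrodingerEvolution_of_phase hn hp hpn hnp a b hb t _
    (2 * Real.pi * y0 * R + 4 * Real.pi ^ 2 * t * R ^ 2)
    (fun η => η 0 * (2 * Real.pi * y0 + 8 * Real.pi ^ 2 * t * R) + 4 * Real.pi ^ 2 * t * η 0 ^ 2 +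
      2 * Real.pi * x 1 * η 1 + 4 * Real.pi ^ 2 * t * η 1 ^ 2)
    (fun η => 2 * Real.pi * (D * x 1 - a / p) + 8 * Real.pi ^ 2 * t * D * η 1) ?_ ?_ ?_
  · intro η _ l
    have hcurve0 : (tangentialCurve α x t) 0 = y0 := by simp [tangentialCurve, hy0]
    have hcurve1 : (tangentialCurve α x t) 1 = x 1 := by simp [tangentialCurve]
    have hnorm : ‖η + !₂[R, l * D]‖ ^ 2 = (η 0 + R) ^ 2 + (η 1 + l * D) ^ 2 := by
      rw [EuclideanSpace.norm_sq_eq, Fin.sum_univ_two]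
      simp
    have hinner : inner ℝ (tangentialCurve α x t) (η + !₂[R, l * D]) =
        y0 * (η 0 + R) + x 1 * (η 1 + l * D) := by
      rw [PiLp.inner_apply, Fin.sum_univ_two, hcurve0, hcurve1]
      simp [mul_comm]
    have hDD : D ^ 2 = (n : ℝ) ^ 16 := by rw [hD]; ring
    have hquad : 2 * Real.pi * (b * (l : ℝ) ^ 2 + a * l) / p =
        4 * Real.pi ^ 2 * t * D ^ 2 * l ^ 2 + 2 * Real.pi * l * (a / p) := by
      rw [hDD, show 4 * Real.pi ^ 2 * t * (n : ℝ) ^ 16 * (l : ℝ) ^ 2 =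
        2 * Real.pi * (2 * Real.pi * t * (n : ℝ) ^ 16) * l ^ 2 by ring, htb]
      ring
    rw [schrodingerPhase, hnorm, hinner, hquad]
    ring
  · rintro η ⟨⟨h0, h0'⟩, h1, h1'⟩
    -- The coefficient of `η₀` is regrouped so that the choice of `b` makes the first term small and
    -- the bound on `t^α` the second.
    have hrw : η 0 * (2 * Real.pi * y0 + 8 * Real.pi ^ 2 * t * R) =
        2 * Real.pi * (η 0 * (4 * Real.pi * t * R + x 0)) - 2 * Real.pi * (η 0 * t ^ α) := by
      rw [hy0]; ring
    have hA : η 0 * (4 * Real.pi * t * R + x 0) ≤ 16 / 1000 := by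
      calc η 0 * (4 * Real.pi * t * R + x 0) ≤
          (n : ℝ) ^ 6 / 1000 * (4 * Real.pi * t * R + x 0) := by gcongr
        _ = (4 * Real.pi * t * R + x 0) * (n : ℝ) ^ 6 / 1000 := by ring
        _ ≤ _ := by gcongr
    have hA0 : 0 ≤ η 0 * (4 * Real.pi * t * R + x 0) := by positivity
    have hB : η 0 * t ^ α ≤ 1 / 1000 := by
      calc η 0 * t ^ α ≤ (n : ℝ) ^ 6 / 1000 * t ^ α := by gcongr
        _ = t ^ α * (n : ℝ) ^ 6 / 1000 := by ring
        _ ≤ _ := by gcongr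
    have hB0 : 0 ≤ η 0 * t ^ α := by positivity
    have hC : t * η 0 ^ 2 ≤ 1 / 10 ^ 6 := by
      calc t * η 0 ^ 2 ≤ t * ((n : ℝ) ^ 6 / 1000) ^ 2 := by gcongr
        _ = t * R / 10 ^ 6 := by rw [hR]; ring
        _ ≤ 1 / 10 ^ 6 := by gcongr; linarith
    have hC0 : 0 ≤ t * η 0 ^ 2 := by positivity
    have hE : x 1 * η 1 ≤ 1 / 1000 := by
      calc x 1 * η 1 ≤ 1 * (1 / 1000) := by gcongr
        _ = _ := by norm_num
    have hE0 : 0 ≤ x 1 * η 1 := by positivity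
    have hF : t * η 1 ^ 2 ≤ 1 / 10 ^ 6 := by
      calc t * η 1 ^ 2 ≤ 1 * (1 / 1000) ^ 2 := by gcongr
        _ = _ := by norm_num
    have hF0 : 0 ≤ t * η 1 ^ 2 := by positivity
    have hπsq : Real.pi ^ 2 ≤ 10 :=
      (pow_le_pow_left₀ hπ.le hπ4.le 2).trans (by norm_num)
    have hC' : Real.pi ^ 2 * (t * η 0 ^ 2) ≤ 10 * (1 / 10 ^ 6) := by gcongr
    have hF' : Real.pi ^ 2 * (t * η 1 ^ 2) ≤ 10 * (1 / 10 ^ 6) := by gcongr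
    have hA' : Real.pi * (η 0 * (4 * Real.pi * t * R + x 0)) ≤ 3.15 * (16 / 1000) := by gcongr
    have hB' : Real.pi * (η 0 * t ^ α) ≤ 3.15 * (1 / 1000) := by gcongr
    have hE' : Real.pi * (x 1 * η 1) ≤ 3.15 * (1 / 1000) := by gcongr
    have hC0' : 0 ≤ Real.pi ^ 2 * (t * η 0 ^ 2) := by positivity
    have hF0' : 0 ≤ Real.pi ^ 2 * (t * η 1 ^ 2) := by positivity
    have hA0' : 0 ≤ Real.pi * (η 0 * (4 * Real.pi * t * R + x 0)) := by positivity
    have hB0' : 0 ≤ Real.pi * (η 0 * t ^ α) := by positivity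
    have hE0' : 0 ≤ Real.pi * (x 1 * η 1) := by positivity
    simp only [hrw]
    norm_num at hA' hB' hC' hE' hF'
    rw [abs_le]
    constructor <;> linarith
  · rintro η ⟨-, h1, h1'⟩
    have hG : |8 * Real.pi ^ 2 * t * D * η 1| * (n : ℝ) ^ 4 ≤ 2 * Real.pi / 1000 := by
      rw [abs_of_nonneg (by positivity)]
      calc 8 * Real.pi ^ 2 * t * D * η 1 * (n : ℝ) ^ 4 =
          2 * Real.pi * (4 * Real.pi * t * R) * η 1 := by rw [hD, hR]; ring
        _ ≤ 2 * Real.pi * 1 * (1 / 1000) := by gcongr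
        _ = _ := by ring
    have hH : |2 * Real.pi * (D * x 1 - a / p)| * (n : ℝ) ^ 4 ≤ 2 * Real.pi / 100 := by
      rw [abs_mul, abs_of_pos (by positivity : 0 < 2 * Real.pi), mul_assoc]
      calc 2 * Real.pi * (|D * x 1 - a / p| * (n : ℝ) ^ 4) ≤ 2 * Real.pi * (1 / 100) := by gcongr
        _ = _ := by ring
    calc |2 * Real.pi * (D * x 1 - a / p) + 8 * Real.pi ^ 2 * t * D * η 1| * (n : ℝ) ^ 4 ≤
        (|2 * Real.pi * (D * x 1 - a / p)| + |8 * Real.pi ^ 2 * t * D * η 1|) * (n : ℝ) ^ 4 := by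
          gcongr; exact abs_add_le _ _
      _ ≤ 7 / 100 := by rw [add_mul]; linarith

/-! ### Counting prime denominators -/

/-- The primes in `(n² / 4, n²]`. -/
def denominators (n : ℕ) : Finset ℕ := (Finset.Ioc (n ^ 2 / 4) (n ^ 2)).filter Nat.Prime

theorem sum_log_denominators (n : ℕ) :
    ∑ p ∈ denominators n, Real.log p =
      Chebyshev.theta (n ^ 2 : ℕ) - Chebyshev.theta (n ^ 2 / 4 : ℕ) := by
  have hsub : (Finset.Ioc 0 (n ^ 2)).filter Nat.Prime =
      (Finset.Ioc 0 (n ^ 2 / 4)).filter Nat.Prime ∪ denominators n := by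
    rw [denominators, ← Finset.filter_union,
      Finset.Ioc_union_Ioc_eq_Ioc (Nat.zero_le _) (Nat.div_le_self _ _)]
  have hdisj : Disjoint ((Finset.Ioc 0 (n ^ 2 / 4)).filter Nat.Prime) (denominators n) := by
    refine Finset.disjoint_filter_filter ?_
    rw [Finset.disjoint_left]
    intro a ha hb
    simp only [Finset.mem_Ioc] at ha hb
    omega
  simp only [Chebyshev.theta, Nat.floor_natCast]
  rw [hsub, Finset.sum_union hdisj, add_sub_cancel_left]

open Filter in
-- Chebyshev's bounds give `θ(n²) ≥ n² log 2` up to lower order terms and `θ(n²/4) ≤ (n²/4) log 4 =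
-- (n²/2) log 2`, so a positive proportion of `n²` remains; each prime contributes at most `2 log
-- n`. With `n²/2` as lower endpoint these two bounds would cancel.
theorem eventually_card_denominators_ge :
    ∀ᶠ n : ℕ in atTop, (n : ℝ) ^ 2 / 10 ≤ (denominators n).card * Real.log n := by
  have h1 : ∀ᶠ n : ℕ in atTop, Real.log n ≤ 1 / 100 * (n : ℝ) := by
    have := (Real.isLittleO_log_id_atTop.comp_tendsto tendsto_natCast_atTop_atTop).bound
      (c := 1 / 100) (by norm_num)
    filter_upwards [this, eventually_ge_atTop 1] with n hn hn1
    have hlog : 0 ≤ Real.log n := Real.log_natCast_nonneg n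
    simpa [abs_of_nonneg hlog] using hn
  filter_upwards [h1, eventually_ge_atTop 1000] with n hlog hn
  have hn' : (1000 : ℝ) ≤ n := by exact_mod_cast hn
  have hn0 : (0 : ℝ) < n := by linarith
  have hlower := Chebyshev.theta_ge (n ^ 2)
  have hupper := Chebyshev.theta_le_log4_mul_x (x := ((n ^ 2 / 4 : ℕ) : ℝ)) (Nat.cast_nonneg _)
  have hdiv : ((n ^ 2 / 4 : ℕ) : ℝ) ≤ (n : ℝ) ^ 2 / 4 := by
    have := Nat.cast_div_le (α := ℝ) (m := n ^ 2) (n := 4)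
    push_cast at this
    exact this
  have hlog4 : Real.log 4 = 2 * Real.log 2 := by
    rw [show (4 : ℝ) = 2 ^ 2 by norm_num, Real.log_pow]; norm_num
  have hlog2 := Real.log_two_gt_d9
  have hlogsq : Real.log ((n ^ 2 : ℕ) : ℝ) = 2 * Real.log n := by
    push_cast; rw [Real.log_pow]; norm_num
  have hlogsq1 : Real.log (((n ^ 2 : ℕ) : ℝ) + 1) ≤ 4 * Real.log n := by
    have : ((n ^ 2 : ℕ) : ℝ) + 1 ≤ (n : ℝ) ^ 4 := by
      push_cast
      have h2 : (2 : ℝ) ≤ (n : ℝ) ^ 2 := by nlinarith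
      nlinarith [show (n : ℝ) ^ 4 = n ^ 2 * n ^ 2 by ring]
    refine (Real.log_le_log (by positivity) this).trans ?_
    rw [Real.log_pow]; norm_num
  have hsqrt : √((n ^ 2 : ℕ) : ℝ) = n := by
    push_cast; exact Real.sqrt_sq hn0.le
  have hsum : ∑ p ∈ denominators n, Real.log p ≤ (denominators n).card * (2 * Real.log n) := by
    rw [← nsmul_eq_mul]
    refine Finset.sum_le_card_nsmul _ _ _ fun p hp => ?_
    simp only [denominators, Finset.mem_filter, Finset.mem_Ioc] at hp
    rw [← hlogsq]
    exact Real.log_le_log (by exact_mod_cast hp.2.pos) (by exact_mod_cast hp.1.2)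
  rw [sum_log_denominators] at hsum
  rw [hsqrt, hlogsq] at hlower
  push_cast at hlower hlogsq1
  rw [hlog4] at hupper
  have hupper' : 2 * Real.log 2 * ((n ^ 2 / 4 : ℕ) : ℝ) ≤ 2 * Real.log 2 * ((n : ℝ) ^ 2 / 4) := by
    gcongr
  have hnn : 4 * (n : ℝ) * Real.log n ≤ 4 * n * (1 / 100 * n) := by gcongr
  have hlogn : 4 * Real.log n ≤ 1 / 1000 * (n : ℝ) ^ 2 := by nlinarith
  have h2 : (0.69 : ℝ) * (n : ℝ) ^ 2 ≤ Real.log 2 * (n : ℝ) ^ 2 := by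
    gcongr; linarith
  have hcast : Chebyshev.theta ((n ^ 2 : ℕ) : ℝ) = Chebyshev.theta ((n : ℝ) ^ 2) := by push_cast; rfl
  rw [hcast] at hsum
  nlinarith

/-! ### Fractions and the good set -/

/-- The pairs of a prime denominator `p` and `(k, r)`, standing for the fraction `k + r / p`. -/
def fractionIndex (n : ℕ) : Finset (Σ _ : ℕ, ℕ × ℕ) :=
  (denominators n).sigma fun p => Finset.range (n ^ 8 / 2) ×ˢ Finset.Ico 1 p

/-- The numerator of the fraction `k + r / p`. -/
def fractionNum (i : Σ _ : ℕ, ℕ × ℕ) : ℕ := i.2.1 * i.1 + i.2.2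

theorem card_fractionIndex_ge {n : ℕ} (hn : 40 ≤ n) :
    ((denominators n).card : ℝ) * ((n : ℝ) ^ 10 / 32) ≤ (fractionIndex n).card := by
  rw [fractionIndex, Finset.card_sigma]
  push_cast
  rw [← nsmul_eq_mul]
  refine Finset.card_nsmul_le_sum _ _ _ fun p hp => ?_
  simp only [denominators, Finset.mem_filter, Finset.mem_Ioc] at hp
  rw [Finset.card_product, Finset.card_range, Nat.card_Ico]
  have hn1 : 1 ≤ n := by linarith
  have h8 : 40 ^ 2 ≤ n ^ 2 := Nat.pow_le_pow_left hn 2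
  have h8' : 40 ≤ n ^ 8 := hn.trans (Nat.le_self_pow (by norm_num) n)
  have hK : n ^ 8 ≤ 4 * (n ^ 8 / 2) := by omega
  have hp1 : n ^ 2 ≤ 8 * (p - 1) := by omega
  have hK' : (n : ℝ) ^ 8 ≤ 4 * (n ^ 8 / 2 : ℕ) := by exact_mod_cast hK
  have hp1' : (n : ℝ) ^ 2 ≤ 8 * (p - 1 : ℕ) := by exact_mod_cast hp1
  have : (n : ℝ) ^ 10 / 32 ≤ ((n ^ 8 / 2 : ℕ) : ℝ) * ((p - 1 : ℕ) : ℝ) := by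
    calc (n : ℝ) ^ 10 / 32 = (n : ℝ) ^ 8 * (n : ℝ) ^ 2 / 32 := by ring
      _ ≤ (4 * ((n ^ 8 / 2 : ℕ) : ℝ)) * (8 * ((p - 1 : ℕ) : ℝ)) / 32 := by gcongr
      _ = ((n ^ 8 / 2 : ℕ) : ℝ) * ((p - 1 : ℕ) : ℝ) := by ring
  exact_mod_cast this

/-- As `1 ≤ r < p`, the fraction `k + r/p` is in lowest terms and so determines its prime
denominator; division with remainder then recovers `k` and `r`. -/
theorem fractionNum_mul_injective {n : ℕ} {i j : Σ _ : ℕ, ℕ × ℕ} (hi : i ∈ fractionIndex n)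
    (hj : j ∈ fractionIndex n) (h : fractionNum i * j.1 = fractionNum j * i.1) : i = j := by
  obtain ⟨p, k, r⟩ := i
  obtain ⟨q, k', r'⟩ := j
  simp only [fractionIndex, denominators, Finset.mem_sigma, Finset.mem_filter, Finset.mem_product,
    Finset.mem_Ico] at hi hj
  simp only [fractionNum] at h
  have hp : p.Prime := hi.1.2
  have hq : q.Prime := hj.1.2
  have hpq : p = q := by
    by_contra hne
    have h1 : p ∣ (k * p + r) * q := h ▸ dvd_mul_left _ _
    rcases hp.dvd_mul.mp h1 with h2 | h2
    · have h3 : p ∣ r := (Nat.dvd_add_right (dvd_mul_left _ _)).mp h2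
      have := Nat.le_of_dvd (by omega) h3
      omega
    · exact hne ((Nat.prime_dvd_prime_iff_eq hp hq).mp h2)
  subst hpq
  have h4 : k * p + r = k' * p + r' := Nat.eq_of_mul_eq_mul_right hp.pos h
  have hr : r = r' := by
    have := congrArg (· % p) h4
    simpa [Nat.mod_eq_of_lt hi.2.2.2, Nat.mod_eq_of_lt hj.2.2.2] using this
  subst hr
  have hk : k = k' := Nat.eq_of_mul_eq_mul_right hp.pos (by omega)
  subst hk
  rfl

/-- The points of the plane with first coordinate in `[-1/2, -1/4]` and second coordinate close to
`n⁻⁸` times the fraction with index `i`. -/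
noncomputable def fractionBox (n : ℕ) (i : Σ _ : ℕ, ℕ × ℕ) : Set Plane :=
  planeBox (-1 / 2) (-1 / 4)
    ((fractionNum i / i.1 - 1 / (100 * (n : ℝ) ^ 4)) / (n : ℝ) ^ 8)
    ((fractionNum i / i.1 + 1 / (100 * (n : ℝ) ^ 4)) / (n : ℝ) ^ 8)

theorem volume_fractionBox {n : ℕ} (hn : 1 ≤ n) (i : Σ _ : ℕ, ℕ × ℕ) :
    volume (fractionBox n i) = ENNReal.ofReal (1 / (200 * (n : ℝ) ^ 12)) := by
  have hn0 : (0 : ℝ) < n := by exact_mod_cast hn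
  rw [fractionBox, volume_planeBox, ← ENNReal.ofReal_mul (by norm_num)]
  congr 1
  field_simp
  ring

theorem abs_sub_le_of_mem_fractionBox {n : ℕ} (hn : 1 ≤ n) {i : Σ _ : ℕ, ℕ × ℕ} {x : Plane}
    (hx : x ∈ fractionBox n i) :
    |(n : ℝ) ^ 8 * x 1 - fractionNum i / i.1| * (n : ℝ) ^ 4 ≤ 1 / 100 := by
  have hn0 : (0 : ℝ) < n := by exact_mod_cast hn
  obtain ⟨-, h1, h2⟩ := hx
  rw [div_le_iff₀ (by positivity)] at h1
  rw [le_div_iff₀ (by positivity)] at h2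
  have habs : |(n : ℝ) ^ 8 * x 1 - fractionNum i / i.1| ≤ 1 / (100 * (n : ℝ) ^ 4) := by
    rw [abs_le]
    constructor <;> linarith
  calc _ ≤ 1 / (100 * (n : ℝ) ^ 4) * (n : ℝ) ^ 4 := by gcongr
    _ = 1 / 100 := by field_simp

/-- Distinct fractions with denominators at most `n²` differ by at least `n⁻⁴`, whereas a common
point would put them within `n⁻⁴/50`. -/
theorem disjoint_fractionBox {n : ℕ} (hn : 1 ≤ n) :
    Set.PairwiseDisjoint (↑(fractionIndex n)) (fractionBox n) := by
  have hn0 : (0 : ℝ) < n := by exact_mod_cast hn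
  intro i hi j hj hij
  refine Set.disjoint_left.mpr fun x hx hx' => hij ?_
  refine fractionNum_mul_injective hi hj ?_
  have h1 := abs_sub_le_of_mem_fractionBox hn hx
  have h2 := abs_sub_le_of_mem_fractionBox hn hx'
  have hmem : ∀ i ∈ fractionIndex n, 0 < i.1 ∧ i.1 ≤ n ^ 2 := by
    intro i hi
    simp only [fractionIndex, denominators, Finset.mem_sigma, Finset.mem_filter,
      Finset.mem_Ioc] at hi
    exact ⟨hi.1.2.pos, hi.1.1.2⟩
  obtain ⟨hp, hpn⟩ := hmem i hi
  obtain ⟨hq, hqn⟩ := hmem j hj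
  set p := i.1
  set q := j.1
  have hp' : (0 : ℝ) < p := by exact_mod_cast hp
  have hq' : (0 : ℝ) < q := by exact_mod_cast hq
  have hpn' : (p : ℝ) ≤ (n : ℝ) ^ 2 := by exact_mod_cast hpn
  have hqn' : (q : ℝ) ≤ (n : ℝ) ^ 2 := by exact_mod_cast hqn
  have h3 : |(fractionNum i : ℝ) / p - fractionNum j / q| * (n : ℝ) ^ 4 ≤ 1 / 50 := by
    have : |(fractionNum i : ℝ) / p - fractionNum j / q| ≤
        |(n : ℝ) ^ 8 * x 1 - fractionNum i / p| + |(n : ℝ) ^ 8 * x 1 - fractionNum j / q| := by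
      rw [abs_sub_comm ((n : ℝ) ^ 8 * x 1) (fractionNum i / p)]
      exact abs_sub_le _ _ _
    calc _ ≤ (|(n : ℝ) ^ 8 * x 1 - fractionNum i / p| +
          |(n : ℝ) ^ 8 * x 1 - fractionNum j / q|) * (n : ℝ) ^ 4 := by gcongr
      _ ≤ 1 / 50 := by rw [add_mul]; linarith
  have h4 : |((fractionNum i * q : ℤ) - (fractionNum j * p : ℤ) : ℤ)| < 1 := by
    have h5 : |(fractionNum i : ℝ) * q - fractionNum j * p| < 1 := by
      have h6 : (fractionNum i : ℝ) * q - fractionNum j * p =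
          ((fractionNum i : ℝ) / p - fractionNum j / q) * (p * q) := by
        field_simp
      rw [h6, abs_mul, abs_of_pos (mul_pos hp' hq')]
      calc _ ≤ |(fractionNum i : ℝ) / p - fractionNum j / q| * ((n : ℝ) ^ 2 * (n : ℝ) ^ 2) := by
            gcongr
        _ = |(fractionNum i : ℝ) / p - fractionNum j / q| * (n : ℝ) ^ 4 := by ring
        _ < 1 := by linarith
    exact_mod_cast h5
  have h7 := Int.abs_lt_one_iff.mp h4
  have h8 : (fractionNum i * q : ℤ) = (fractionNum j * p : ℤ) := by omega
  exact_mod_cast h8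

/-- The lower bound uses `r ≥ 1`, since `r/p ≥ n⁻²` exceeds the radius; the upper bound comes from
`k < n⁸/2`. Together with `x₀ ∈ [-1/2, -1/4]` this keeps the box inside the unit ball. -/
theorem fractionBox_bounds {n : ℕ} (hn : 40 ≤ n) {i : Σ _ : ℕ, ℕ × ℕ} (hi : i ∈ fractionIndex n)
    {x : Plane} (hx : x ∈ fractionBox n i) : x 1 ∈ Set.Icc (0 : ℝ) (3 / 4) := by
  have hn' : (40 : ℝ) ≤ n := by exact_mod_cast hn
  obtain ⟨p, k, r⟩ := i
  simp only [fractionIndex, denominators, Finset.mem_sigma, Finset.mem_filter, Finset.mem_product,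
    Finset.mem_Ico, Finset.mem_Ioc, Finset.mem_range] at hi
  obtain ⟨⟨⟨-, hpn⟩, hp⟩, hk, hr1, hrp⟩ := hi
  obtain ⟨-, h1, h2⟩ := hx
  simp only [fractionNum] at h1 h2
  have hp0 : (0 : ℝ) < p := by exact_mod_cast hp.pos
  have hpn' : (p : ℝ) ≤ (n : ℝ) ^ 2 := by exact_mod_cast hpn
  have hr1' : (1 : ℝ) ≤ r := by exact_mod_cast hr1
  have hrp' : (r : ℝ) ≤ p := by exact_mod_cast hrp.le
  have hn8 : (0 : ℝ) < (n : ℝ) ^ 8 := by positivity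
  have hfrac : ((k * p + r : ℕ) : ℝ) / p = k + r / p := by
    push_cast; field_simp
  rw [hfrac] at h1 h2
  have hk' : (k : ℝ) + 1 ≤ (n : ℝ) ^ 8 / 2 := by
    have h3 : 2 * (k + 1) ≤ n ^ 8 := by omega
    have h4 : 2 * ((k : ℝ) + 1) ≤ (n : ℝ) ^ 8 := by exact_mod_cast h3
    linarith
  have hr : (r : ℝ) / p ≤ 1 := (div_le_one hp0).mpr hrp'
  have hn4 : 1 / (100 * (n : ℝ) ^ 4) ≤ 1 := by
    rw [div_le_one (by positivity)]
    have : (1 : ℝ) ≤ (n : ℝ) ^ 4 := one_le_pow₀ (by linarith)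
    linarith
  have hlow : 1 / (100 * (n : ℝ) ^ 4) ≤ r / p := by
    refine div_le_div₀ (by positivity) hr1' hp0 ?_
    have : (1 : ℝ) ≤ (n : ℝ) ^ 2 := one_le_pow₀ (by linarith)
    nlinarith [show (n : ℝ) ^ 4 = n ^ 2 * n ^ 2 by ring]
  have hk0 : (0 : ℝ) ≤ k := Nat.cast_nonneg k
  refine ⟨le_trans (div_nonneg (by linarith) hn8.le) h1, h2.trans ?_⟩
  rw [div_le_iff₀ hn8]
  have : (40 : ℝ) ≤ (n : ℝ) ^ 8 := hn'.trans (le_self_pow₀ (by linarith) (by norm_num))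
  linarith

theorem fractionBox_subset_ball {n : ℕ} (hn : 40 ≤ n) {i : Σ _ : ℕ, ℕ × ℕ}
    (hi : i ∈ fractionIndex n) : fractionBox n i ⊆ Metric.ball 0 1 := by
  intro x hx
  obtain ⟨h1, h2⟩ := fractionBox_bounds hn hi hx
  obtain ⟨⟨h3, h4⟩, -⟩ := hx
  rw [mem_ball_zero_iff, EuclideanSpace.norm_eq, Fin.sum_univ_two, Real.sqrt_lt' one_pos]
  simp only [Real.norm_eq_abs, sq_abs]
  nlinarith

/-! ### Lower bound for the maximal norm and comparison of exponents -/

theorem le_tangentialMaximalNorm_frequencyComb {α : ℝ} (hα : 1 / 2 ≤ α) {n : ℕ} (hn : 40 ≤ n) :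
    ENNReal.ofReal ((fractionIndex n).card * ((n : ℝ) ^ 9 / 8000000 / (200 * (n : ℝ) ^ 12))) ≤
      tangentialMaximalNorm α ((frequencyComb n).indicator 1) := by
  have hn1 : 1 ≤ n := by linarith
  set sup : Plane → ℝ≥0∞ := fun x => ⨆ t ∈ Set.Ioo (0 : ℝ) 1,
    ‖schrodingerEvolution ((frequencyComb n).indicator 1) t (tangentialCurve α x t)‖ₑ with hsup
  have hpoint : ∀ i ∈ fractionIndex n, ∀ x ∈ fractionBox n i,
      ENNReal.ofReal ((n : ℝ) ^ 9 / 8000000) ≤ sup x := by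
    intro i hi x hx
    obtain ⟨hx0, hx1⟩ := fractionBox_bounds hn hi hx
    have hmem := hi
    simp only [fractionIndex, denominators, Finset.mem_sigma, Finset.mem_filter,
      Finset.mem_Ioc] at hmem
    obtain ⟨t, ht, hle⟩ := exists_time_le_norm_schrodingerEvolution hα hn hmem.1.2 hmem.1.1.2
      (by omega) (fractionNum i : ℤ) hx.1 ⟨hx0, by linarith⟩
      (by simpa using abs_sub_le_of_mem_fractionBox hn1 hx)
    rw [hsup]
    refine le_trans ?_ (le_iSup₂ (f := fun t (_ : t ∈ Set.Ioo (0 : ℝ) 1) =>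
      ‖schrodingerEvolution ((frequencyComb n).indicator 1) t (tangentialCurve α x t)‖ₑ) t ht)
    rw [← ofReal_norm]
    exact ENNReal.ofReal_le_ofReal hle
  have hmeas : ∀ i ∈ fractionIndex n, MeasurableSet (fractionBox n i) := fun i _ =>
    measurableSet_planeBox _ _ _ _
  calc ENNReal.ofReal ((fractionIndex n).card * ((n : ℝ) ^ 9 / 8000000 / (200 * (n : ℝ) ^ 12)))
      = ∑ i ∈ fractionIndex n,
          ENNReal.ofReal ((n : ℝ) ^ 9 / 8000000) * volume (fractionBox n i) := by
        simp_rw [volume_fractionBox hn1, ← ENNReal.ofReal_mul (show 0 ≤ (n : ℝ) ^ 9 / 8000000 by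
          positivity)]
        rw [Finset.sum_const, nsmul_eq_mul, ENNReal.ofReal_mul (by positivity),
          ENNReal.ofReal_natCast, mul_one_div]
    _ ≤ ∑ i ∈ fractionIndex n, ∫⁻ x in fractionBox n i, sup x := by
        refine Finset.sum_le_sum fun i hi => ?_
        rw [← setLIntegral_const]
        exact setLIntegral_mono' (hmeas i hi) (hpoint i hi)
    _ = ∫⁻ x in ⋃ i ∈ fractionIndex n, fractionBox n i, sup x :=
        (lintegral_biUnion_finset (disjoint_fractionBox hn1) hmeas sup).symm
    _ ≤ ∫⁻ x in Metric.ball 0 1, sup x :=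
        lintegral_mono_set (Set.iUnion₂_subset fun i hi => fractionBox_subset_ball hn hi)
    _ = _ := rfl

open Filter in
theorem mainTheorem7 (α : ℝ) (hα : α ∈ Set.Ico (1 / 2 : ℝ) 1) (s : ℝ)
    (hest : TangentialMaximalEstimate α s) : 1 / 3 ≤ s := by
  by_contra! hs
  obtain ⟨C, hC⟩ := hest.indicator_le
  -- A nonnegative exponent is needed to pass from the upper bound for `1 + |ξ|²` to one for the
  -- Sobolev weight.
  set σ := max s 0 with hσ
  have hσ0 : 0 ≤ σ := le_max_right _ _
  have hσ3 : 12 * σ < 4 := by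
    have : σ < 1 / 3 := max_lt hs (by norm_num)
    linarith
  have hlittle : ∀ᶠ n : ℕ in atTop,
      ((512 * 10 ^ 9 : ℝ) * (C * (9 ^ (σ / 2) / 1000)) + 1) * Real.log n ≤
        (n : ℝ) ^ (4 - 12 * σ) := by
    set A := (512 * 10 ^ 9 : ℝ) * (C * (9 ^ (σ / 2) / 1000)) + 1 with hA
    have hA0 : 0 < A := by positivity
    have := ((isLittleO_log_rpow_atTop (show 0 < 4 - 12 * σ by linarith)).comp_tendsto
      tendsto_natCast_atTop_atTop).bound (c := A⁻¹) (by positivity)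
    filter_upwards [this] with n hn
    simp only [Function.comp_apply, Real.norm_eq_abs] at hn
    rw [abs_of_nonneg (Real.log_natCast_nonneg n),
      abs_of_nonneg (Real.rpow_nonneg (Nat.cast_nonneg n) _)] at hn
    rwa [le_inv_mul_iff₀ hA0] at hn
  obtain ⟨n, hlog, hcard, hn⟩ :=
    (hlittle.and (eventually_card_denominators_ge.and (eventually_ge_atTop 40))).exists
  have hn1 : 1 ≤ n := by linarith
  have hn' : (40 : ℝ) ≤ n := by exact_mod_cast hn
  have hn0 : (0 : ℝ) < n := by linarith
  have hlog0 : 0 < Real.log n := Real.log_pos (by linarith)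
  have hweight : ∀ ξ ∈ frequencyComb n,
      (1 + ‖ξ‖ ^ 2) ^ (s / 2) ≤ 9 ^ (σ / 2) * (n : ℝ) ^ (12 * σ) := by
    intro ξ hξ
    calc (1 + ‖ξ‖ ^ 2) ^ (s / 2) ≤ (1 + ‖ξ‖ ^ 2) ^ (σ / 2) :=
          Real.rpow_le_rpow_of_exponent_le (by simp) (by linarith [le_max_left s 0])
      _ ≤ (9 * (n : ℝ) ^ 24) ^ (σ / 2) :=
          Real.rpow_le_rpow (by positivity) (norm_sq_le_of_mem_frequencyComb hn1 hξ) (by positivity)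
      _ = 9 ^ (σ / 2) * (n : ℝ) ^ (12 * σ) := by
          rw [Real.mul_rpow (by norm_num) (by positivity), ← Real.rpow_natCast,
            ← Real.rpow_mul hn0.le]
          congr 2
          push_cast
          ring
  have hvol := volume_frequencyComb_le n
  have hupper := hC (frequencyComb n) _ (measurableSet_frequencyComb n)
    (ne_top_of_le_ne_top ENNReal.ofReal_ne_top hvol) (by positivity) hweight
  have hsqrt : √(volume.real (frequencyComb n)) ≤ (n : ℝ) ^ 5 / 1000 := by
    refine Real.sqrt_le_iff.mpr ⟨by positivity, ?_⟩
    refine (ENNReal.toReal_le_of_le_ofReal (by positivity) hvol).trans (le_of_eq ?_)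
    ring
  have hle := (ENNReal.ofReal_le_ofReal_iff (by positivity)).mp
    ((le_tangentialMaximalNorm_frequencyComb hα.1 hn).trans hupper)
  have h1 : (n : ℝ) ^ 12 / 320 ≤ (fractionIndex n).card * Real.log n := by
    calc (n : ℝ) ^ 12 / 320 = (n : ℝ) ^ 2 / 10 * ((n : ℝ) ^ 10 / 32) := by ring
      _ ≤ (denominators n).card * Real.log n * ((n : ℝ) ^ 10 / 32) := by gcongr
      _ = (denominators n).card * ((n : ℝ) ^ 10 / 32) * Real.log n := by ring
      _ ≤ (fractionIndex n).card * Real.log n := by gcongr; exact card_fractionIndex_ge hn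
  -- The constant is `320 · 8000000 · 200 = 512 · 10⁹`.
  have h2 : (n : ℝ) ^ 9 / (512 * 10 ^ 9) ≤
      C * (9 ^ (σ / 2) * (n : ℝ) ^ (12 * σ) * ((n : ℝ) ^ 5 / 1000)) * Real.log n := by
    calc (n : ℝ) ^ 9 / (512 * 10 ^ 9) = (n : ℝ) ^ 12 / 320 *
          ((n : ℝ) ^ 9 / 8000000 / (200 * (n : ℝ) ^ 12)) := by field_simp; norm_num
      _ ≤ (fractionIndex n).card * Real.log n *
          ((n : ℝ) ^ 9 / 8000000 / (200 * (n : ℝ) ^ 12)) := by gcongr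
      _ = (fractionIndex n).card * ((n : ℝ) ^ 9 / 8000000 / (200 * (n : ℝ) ^ 12)) *
          Real.log n := by ring
      _ ≤ C * (9 ^ (σ / 2) * (n : ℝ) ^ (12 * σ) * √(volume.real (frequencyComb n))) *
          Real.log n := by gcongr
      _ ≤ _ := by gcongr
  have h3 : (n : ℝ) ^ (12 * σ) * (n : ℝ) ^ (4 - 12 * σ) = (n : ℝ) ^ 4 := by
    rw [← Real.rpow_add hn0, ← Real.rpow_natCast]
    congr 1
    push_cast
    ring
  set T := (n : ℝ) ^ (12 * σ) with hT
  have hT0 : 0 < T := Real.rpow_pos_of_pos hn0 _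
  set P := (512 * 10 ^ 9 : ℝ) * (C * (9 ^ (σ / 2) / 1000)) with hP
  have h4 : (n : ℝ) ^ 4 ≤ P * Real.log n * T := by
    rw [div_le_iff₀ (by positivity)] at h2
    have hn5 : (0 : ℝ) < (n : ℝ) ^ 5 := by positivity
    refine le_of_mul_le_mul_right ?_ hn5
    calc (n : ℝ) ^ 4 * (n : ℝ) ^ 5 = (n : ℝ) ^ 9 := by ring
      _ ≤ _ := h2
      _ = _ := by rw [hP]; ring
  have h5 : T * ((P + 1) * Real.log n) ≤ (n : ℝ) ^ 4 := by
    rw [← h3]; gcongr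
  have h6 : 0 < T * Real.log n := by positivity
  linarith [show T * ((P + 1) * Real.log n) = P * Real.log n * T + T * Real.log n by ring]
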